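/- Let $X$ be the graph with vertex set $\mathbb{Z}^2$ in which two vertices are adjacent exactly when their $\ell_1$-distance is $1$. For $A\subseteq\mathbb{Z}^2$ let $\partial A$ be the set of vertices not in $A$ that are adjacent to some vertex of $A$. A finite set $A\subset\mathbb{Z}^2$ is called minimal if $|\partial A|\le|\partial B|$ for every $B\subset\mathbb{Z}^2$ with $|B|=|A|$. Two subsets of $\mathbb{Z}^2$ are congruent if some graph automorphism of $X$ maps one onto the other. A set $A$ is connected if any two of its vertices are joined by a path of $X$ contained in $A$ (so the empty set is connected). Let $B(0,2)=\{(x,y)\in\mathbb{Z}^2 : 0\le y-x\le 0,\ 0\le y+x\le 2\}=\{(0,0),(1,1)\}$. A cone is a subset of $\mathbb{Z}^2$ congruent to $\{(x,y)\in\mathbb{Z}^2 : y-x\ge 0,\ y+x\ge 0\}$. Let $A\subset\mathbb{Z}^2$ be a minimal set. Then $A$ is connected if and only if $A$ is not congruent to $B(0,2)$. Moreover, the complement $\mathbb{Z}^2\setminus A$ is a union of cones. -/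

import Mathlib

namespace L1Lattice

/-- The graph `X` on the vertex set `ℤ²`: two vertices are adjacent iff their `ℓ¹`-distance is one. -/
def X : SimpleGraph (ℤ × ℤ) where
  Adj u v := |u.1 - v.1| + |u.2 - v.2| = 1
  symm := ⟨fun u v h => by rw [abs_sub_comm v.1, abs_sub_comm v.2]; exact h⟩
  loopless := ⟨fun u h => by simp at h⟩

/-- The vertex boundary of a set of vertices of a graph. -/
def vertexBoundary {V : Type*} (G : SimpleGraph V) (A : Set V) : Set V :=
  {u | u ∉ A ∧ ∃ v ∈ A, G.Adj u v}

/-- A finite set of vertices is minimal if its vertex boundary is smallest possible among all sets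
with the same number of vertices. -/
def IsMinimal {V : Type*} (G : SimpleGraph V) (A : Set V) : Prop :=
  A.Finite ∧ ∀ B : Set V, B.encard = A.encard →
    (vertexBoundary G A).encard ≤ (vertexBoundary G B).encard

/-- Two sets of vertices are congruent if a graph automorphism maps one onto the other. -/
def Congruent {V : Type*} (G : SimpleGraph V) (A B : Set V) : Prop :=
  ∃ φ : G ≃g G, φ '' A = B

/-- A set of vertices is connected if any two of its points are joined by a path inside it, that is,
if its induced subgraph is connected (the empty set counts as connected). -/
def IsConnectedSet {V : Type*} (G : SimpleGraph V) (A : Set V) : Prop :=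
  (G.induce A).Preconnected

/-- The box `B(α, β)`. -/
def box (α β : ℕ) : Set (ℤ × ℤ) :=
  {p | (0 ≤ p.2 - p.1 ∧ p.2 - p.1 ≤ α) ∧ (0 ≤ p.2 + p.1 ∧ p.2 + p.1 ≤ β)}

/-- The cone above the origin. -/
def standardCone : Set (ℤ × ℤ) := {p | 0 ≤ p.2 - p.1 ∧ 0 ≤ p.2 + p.1}

/-- A cone is a set congruent to the standard cone. -/
def IsCone (C : Set (ℤ × ℤ)) : Prop := Congruent X C standardCone

/-- A set is a union of cones (the empty union is allowed). -/
def IsUnionOfCones (S : Set (ℤ × ℤ)) : Prop :=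
  ∃ 𝒞 : Set (Set (ℤ × ℤ)), (∀ C ∈ 𝒞, IsCone C) ∧ S = ⋃₀ 𝒞

end L1Lattice

/-!
Adding a diagonal vector to a finite set `S` creates a new point on each diagonal line that meets
`S`, and exactly one per line only if `S` is convex along these lines. The set of neighbours of `S`
is, up to a translation, the sum of `S` with the two diagonal segments `{0, (1, 1)}` and
`{0, (1, -1)}`, so the number of neighbours is at least the number of points of `S`, plus the
number of diagonal lines that meet `S`, plus the number of colours of the chessboard colouring that
occur in `S`. Boxes and their subsets provide an upper bound for the boundary of a minimal set `A`
in terms of its size, which is compared with the number of lines through the fact that `k` diagonal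
lines contain at most `k ^ 2 / 4` points in their pairwise intersections.

If both colours occur in `A`, the two bounds agree. Equality makes `A` convex along both diagonal
directions and gives consecutive points of `A` on a line a common neighbour in `A`, so that each
line meets only one component of `A`. Several components would then use more lines than the upper
bound permits. If only one colour occurs, the upper bound leaves only sets with at most one point
and pairs of consecutive points on a diagonal line, that is, the sets congruent to `B(0, 2)`.

For the complement, take `z` outside a connected `A` that is convex along the diagonals. Each of the
two diagonal lines through `z` contains a half-line that misses `A`. These half-lines bound a cone
through whose sides no path in `A` can pass, so `A` misses either this cone or the opposite one.
-/

namespace L1Lattice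

open scoped Finset Pointwise

section ConvexAlong

/-- `S` is convex in the direction `d`: along each line of direction `d`, the points of `S` are
consecutive. -/
def ConvexAlong {M : Type*} [AddMonoid M] (d : M) (S : Set M) : Prop :=
  ∀ ⦃p : M⦄ ⦃m n : ℕ⦄, p ∈ S → p + n • d ∈ S → m ≤ n → p + m • d ∈ S

theorem exists_lt_last_mem {M : Type*} [AddMonoid M] {d p : M} {S : Set M} {m : ℕ}
    (hp : p ∈ S) (hm : p + m • d ∉ S) :
    ∃ n < m, p + n • d ∈ S ∧ p + (n + 1) • d ∉ S := by
  by_contra! h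
  refine hm ?_
  suffices ∀ n ≤ m, p + n • d ∈ S from this m le_rfl
  intro n
  induction n with
  | zero => simpa using hp
  | succ n ih => exact fun hn ↦ h n hn (ih (Nat.le_of_succ_le hn))

theorem apply_add_nsmul {M β : Type*} [AddMonoid M] {d : M} {f : M → β}
    (hf : ∀ p, f (p + d) = f p) (p : M) (n : ℕ) : f (p + n • d) = f p := by
  induction n with
  | zero => simp
  | succ n ih => rw [succ_nsmul, ← add_assoc, hf, ih]

theorem exists_last_mem {M : Type*} [AddLeftCancelMonoid M] {d p : M} {S : Finset M}
    (hd : ¬ IsOfFinAddOrder d) (hp : p ∈ S) : ∃ n : ℕ, p + n • d ∈ S ∧ p + (n + 1) • d ∉ S := by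
  have hinj : Function.Injective fun n : ℕ ↦ p + n • d :=
    (add_right_injective p).comp (injective_nsmul_iff_not_isOfFinAddOrder.2 hd)
  obtain ⟨m, hm⟩ := (S.finite_toSet.preimage hinj.injOn).exists_notMem
  obtain ⟨n, -, hn⟩ := exists_lt_last_mem (S := (S : Set M)) hp hm
  exact ⟨n, hn⟩

variable {M β : Type*} [AddLeftCancelMonoid M] [DecidableEq M] [DecidableEq β]
  {d : M} {f : M → β} {S : Finset M}

theorem subset_add_zero_pair : S ⊆ S + {0, d} :=
  Finset.subset_add_left S (by simp)

theorem add_nsmul_mem_add_pair_sdiff {p : M} {n : ℕ} (hn : p + n • d ∈ S)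
    (hn' : p + (n + 1) • d ∉ S) : p + (n + 1) • d ∈ (S + {0, d}) \ S := by
  refine Finset.mem_sdiff.2 ⟨?_, hn'⟩
  rw [succ_nsmul, ← add_assoc]
  exact Finset.add_mem_add hn (by simp)

theorem image_subset_image_add_pair_sdiff (hd : ¬ IsOfFinAddOrder d)
    (hf : ∀ p, f (p + d) = f p) : S.image f ⊆ ((S + {0, d}) \ S).image f := by
  refine Finset.image_subset_iff.2 fun p hp ↦ ?_
  obtain ⟨n, hn, hn'⟩ := exists_last_mem hd hp
  exact Finset.mem_image.2 ⟨_, add_nsmul_mem_add_pair_sdiff hn hn', apply_add_nsmul hf p _⟩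

theorem card_add_card_image_le_card_add_pair (hd : ¬ IsOfFinAddOrder d)
    (hf : ∀ p, f (p + d) = f p) : #S + #(S.image f) ≤ #(S + {0, d}) := by
  have himage := Finset.card_le_card (image_subset_image_add_pair_sdiff (S := S) hd hf)
  have hcard := Finset.card_sdiff_add_card_eq_card (subset_add_zero_pair (S := S) (d := d))
  have := Finset.card_image_le (s := (S + {0, d}) \ S) (f := f)
  lia

/-- In the equality case each line is left only once. -/
theorem convexAlong_of_card_add_pair_le (hd : ¬ IsOfFinAddOrder d)
    (hf : ∀ p, f (p + d) = f p) (hcard : #(S + {0, d}) ≤ #S + #(S.image f)) :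
    ConvexAlong d (S : Set M) := by
  have hinj : Set.InjOn f ((S + {0, d}) \ S : Finset M) := by
    have himage := Finset.card_le_card (image_subset_image_add_pair_sdiff (S := S) hd hf)
    have := Finset.card_sdiff_add_card_eq_card (subset_add_zero_pair (S := S) (d := d))
    exact Finset.card_image_iff.1 (le_antisymm Finset.card_image_le (by lia))
  intro p m n hp hn hmn
  by_contra hm
  obtain ⟨i, him, hi, hi'⟩ := exists_lt_last_mem hp hm
  obtain ⟨j, hj, hj'⟩ := exists_last_mem hd hn
  have hij := hinj (add_nsmul_mem_add_pair_sdiff hi hi') (add_nsmul_mem_add_pair_sdiff hj hj')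
    (by simp only [apply_add_nsmul hf])
  rw [add_assoc, ← add_nsmul] at hij
  have := injective_nsmul_iff_not_isOfFinAddOrder.2 hd (add_left_cancel hij)
  lia

end ConvexAlong

/-- The diagonal directions `(1, 1)` and `(1, -1)` of `ℤ²`, which are the axes of the boxes. -/
def dir (σ : ℤˣ) : ℤ × ℤ := (1, σ)

/-- The invariant of the lines of direction `dir σ`: `y - x` for `σ = 1` and `y + x` for
`σ = -1`. -/
def lineIndex (σ : ℤˣ) : ℤ × ℤ →+ ℤ where
  toFun p := p.2 - σ * p.1
  map_zero' := by simp
  map_add' p q := by simp only [Prod.fst_add, Prod.snd_add]; ring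

theorem lineIndex_apply (σ : ℤˣ) (p : ℤ × ℤ) : lineIndex σ p = p.2 - σ * p.1 := rfl

theorem lineIndex_add_dir (σ : ℤˣ) (p : ℤ × ℤ) : lineIndex σ (p + dir σ) = lineIndex σ p := by
  simp only [lineIndex_apply, dir, Prod.fst_add, Prod.snd_add]
  ring

theorem lineIndex_neg_dir (σ : ℤˣ) : lineIndex (-σ) (dir σ) = 2 * σ := by
  simp only [lineIndex_apply, dir, Units.val_neg]
  ring

theorem not_isOfFinAddOrder_dir (σ : ℤˣ) : ¬ IsOfFinAddOrder (dir σ) := fun h ↦ by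
  simp [dir, isOfFinAddOrder_iff_nsmul_eq_zero] at h

theorem eq_add_nsmul_dir {σ : ℤˣ} {p q : ℤ × ℤ} (hpq : lineIndex σ p = lineIndex σ q)
    (hle : p.1 ≤ q.1) : q = p + (q.1 - p.1).toNat • dir σ := by
  have hn : ((q.1 - p.1).toNat : ℤ) = q.1 - p.1 := Int.toNat_of_nonneg (by lia)
  simp only [lineIndex_apply] at hpq
  ext
  · simp [dir, hn]
  · simp only [dir, Prod.smul_mk, Prod.snd_add, nsmul_eq_mul, hn]
    linear_combination -hpq

/-- The colour of the chessboard colouring; adjacent vertices have different colours. -/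
def parity (p : ℤ × ℤ) : ℤ := (p.1 + p.2) % 2

theorem lineIndex_emod_two (σ : ℤˣ) (p : ℤ × ℤ) : lineIndex σ p % 2 = parity p := by
  simp only [lineIndex_apply, parity]
  rcases Int.isUnit_iff.1 σ.isUnit with hσ | hσ <;> simp only [hσ] <;> lia

/-- The number of diagonal lines that meet `S`, over both directions. -/
def lineCount (S : Finset (ℤ × ℤ)) : ℕ := #(S.image (lineIndex 1)) + #(S.image (lineIndex (-1)))

theorem card_image_lineIndex_add (σ : ℤˣ) (S : Finset (ℤ × ℤ)) :
    #(S.image (lineIndex σ)) + #(S.image (lineIndex (-σ))) = lineCount S := by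
  rcases Int.units_eq_one_or σ with rfl | rfl
  · rfl
  · rw [neg_neg, add_comm, lineCount]

theorem X_adj_iff {p q : ℤ × ℤ} : X.Adj p q ↔
    p.2 = q.2 ∧ (p.1 = q.1 + 1 ∨ p.1 = q.1 - 1) ∨ p.1 = q.1 ∧ (p.2 = q.2 + 1 ∨ p.2 = q.2 - 1) := by
  change |p.1 - q.1| + |p.2 - q.2| = 1 ↔ _
  rcases abs_cases (p.1 - q.1) with h | h <;> rcases abs_cases (p.2 - q.2) with h' | h' <;> lia

/-- The vertices adjacent to some vertex of `S`, whether or not they lie in `S`. -/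
def neighbors (S : Finset (ℤ × ℤ)) : Finset (ℤ × ℤ) := S + {(1, 0), (-1, 0), (0, 1), (0, -1)}

theorem mem_neighbors {S : Finset (ℤ × ℤ)} {p : ℤ × ℤ} :
    p ∈ neighbors S ↔ ∃ q ∈ S, X.Adj p q := by
  simp only [neighbors, Finset.mem_add, X_adj_iff]
  refine exists_congr fun q ↦ and_congr_right fun _ ↦ ?_
  constructor
  · rintro ⟨r, hr, rfl⟩
    simp only [Finset.mem_insert, Finset.mem_singleton] at hr
    rcases hr with rfl | rfl | rfl | rfl <;> simp [sub_eq_add_neg]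
  · intro h
    refine ⟨p - q, ?_, add_sub_cancel q p⟩
    simp only [Finset.mem_insert, Finset.mem_singleton, Prod.ext_iff, Prod.fst_sub, Prod.snd_sub]
    lia

/-- The four unit vectors form a parallelogram with sides `dir σ` and `dir (-σ)`. -/
theorem neighbors_eq_add_add (σ : ℤˣ) (S : Finset (ℤ × ℤ)) :
    neighbors S = S + {0, dir σ} + {0, dir (-σ)} + {(-1, 0)} := by
  rw [neighbors, add_assoc S, add_assoc S]
  rcases Int.units_eq_one_or σ with rfl | rfl <;> congr 1 <;> decide

theorem image_parity (σ : ℤˣ) (S : Finset (ℤ × ℤ)) :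
    (S.image (lineIndex σ)).image (· % 2) = S.image parity := by
  rw [Finset.image_image]
  exact Finset.image_congr fun p _ ↦ lineIndex_emod_two σ p

theorem not_isOfFinAddOrder_two_mul (σ : ℤˣ) : ¬ IsOfFinAddOrder (2 * σ : ℤ) := by
  simp [isOfFinAddOrder_iff_nsmul_eq_zero]

theorem image_lineIndex_add_pair (σ : ℤˣ) (S : Finset (ℤ × ℤ)) :
    (S + {0, dir σ}).image (lineIndex (-σ)) = S.image (lineIndex (-σ)) + {0, (2 * σ : ℤ)} := by
  rw [Finset.image_add, Finset.image_insert, Finset.image_singleton, map_zero, lineIndex_neg_dir]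

theorem card_image_lineIndex_add_card_image_parity_le (σ : ℤˣ) (S : Finset (ℤ × ℤ)) :
    #(S.image (lineIndex (-σ))) + #(S.image parity) ≤
      #((S + {0, dir σ}).image (lineIndex (-σ))) := by
  rw [image_lineIndex_add_pair, ← image_parity (-σ)]
  exact card_add_card_image_le_card_add_pair (not_isOfFinAddOrder_two_mul σ) fun n ↦ by lia

theorem card_neighbors (σ : ℤˣ) (S : Finset (ℤ × ℤ)) :
    #(neighbors S) = #(S + {0, dir σ} + {0, dir (-σ)}) := by
  rw [neighbors_eq_add_add σ, Finset.card_add_singleton]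

theorem card_add_card_image_lineIndex_le (σ : ℤˣ) (S : Finset (ℤ × ℤ)) :
    #S + #(S.image (lineIndex σ)) ≤ #(S + {0, dir σ}) :=
  card_add_card_image_le_card_add_pair (not_isOfFinAddOrder_dir σ) (lineIndex_add_dir σ)

theorem card_add_lineCount_add_card_image_parity_le (S : Finset (ℤ × ℤ)) :
    #S + lineCount S + #(S.image parity) ≤ #(neighbors S) := by
  rw [card_neighbors 1, ← card_image_lineIndex_add 1]
  linarith [card_add_card_image_lineIndex_le 1 S,
    card_image_lineIndex_add_card_image_parity_le 1 S,
    card_add_card_image_lineIndex_le (-1) (S + {0, dir 1})]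

/-- Equality in `card_add_lineCount_add_card_image_parity_le` forces equality in each of the three
inequalities whose sum it is. -/
theorem convexAlong_of_card_neighbors_le (σ : ℤˣ) {S : Finset (ℤ × ℤ)}
    (hcard : #(neighbors S) ≤ #S + lineCount S + #(S.image parity)) :
    ConvexAlong (dir σ) (S : Set (ℤ × ℤ)) ∧
      ConvexAlong (dir (-σ)) (↑(S + {0, dir σ}) : Set (ℤ × ℤ)) := by
  rw [card_neighbors σ, ← card_image_lineIndex_add σ] at hcard
  have h₁ := card_add_card_image_lineIndex_le σ S
  have h₂ := card_image_lineIndex_add_card_image_parity_le σ S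
  have h₃ := card_add_card_image_lineIndex_le (-σ) (S + {0, dir σ})
  constructor <;>
    exact convexAlong_of_card_add_pair_le (not_isOfFinAddOrder_dir _) (lineIndex_add_dir _)
      (by lia)

theorem mem_add_pair {M : Type*} [AddGroup M] [DecidableEq M] {S : Finset M} {d p : M} :
    p ∈ S + {0, d} ↔ p ∈ S ∨ p - d ∈ S := by
  simp [Finset.mem_add, ← eq_sub_iff_add_eq, and_or_left, exists_or]

/-- Without a common neighbour of `p` and `p + dir σ` in `A`, the neighbours of these two points in
`A` put `p - (0, σ)` and `p - (0, σ) + 2 • dir σ` into `A + {0, dir (-σ)}`; the point between them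
then provides a common neighbour. -/
theorem exists_common_neighbor {σ : ℤˣ} {A : Finset (ℤ × ℤ)} {p : ℤ × ℤ}
    (hconv : ConvexAlong (dir σ) (↑(A + {0, dir (-σ)}) : Set (ℤ × ℤ))) (hA : A ⊆ neighbors A)
    (hp : p ∈ A) (hq : p + dir σ ∈ A) : ∃ t ∈ A, X.Adj p t ∧ X.Adj (p + dir σ) t := by
  obtain ⟨p', hp', hpp'⟩ := mem_neighbors.1 (hA hp)
  obtain ⟨q', hq', hqq'⟩ := mem_neighbors.1 (hA hq)
  by_contra! h
  have hpq' := h p' hp' hpp'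
  have hqp' := mt (h q' hq') (not_not.2 hqq')
  have hσ := Int.isUnit_iff.1 σ.isUnit
  have hfirst : p' = p - ((0 : ℤ), (σ : ℤ)) ∨ p' = p - ((0 : ℤ), (σ : ℤ)) - dir (-σ) := by
    simp only [X_adj_iff, dir, Prod.ext_iff, Prod.fst_add, Prod.snd_add, Prod.fst_sub,
      Prod.snd_sub, Units.val_neg] at hpp' hpq' ⊢
    lia
  have hlast : q' = p - ((0 : ℤ), (σ : ℤ)) + 2 • dir σ ∨
      q' = p - ((0 : ℤ), (σ : ℤ)) + 2 • dir σ - dir (-σ) := by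
    simp only [X_adj_iff, dir, Prod.ext_iff, Prod.fst_add, Prod.snd_add, Prod.fst_sub,
      Prod.snd_sub, Prod.smul_mk, nsmul_eq_mul, Units.val_neg] at hqq' hqp' ⊢
    lia
  have hmid := hconv (mem_add_pair.2 <| hfirst.imp (· ▸ hp') (· ▸ hp'))
    (mem_add_pair.2 <| hlast.imp (· ▸ hq') (· ▸ hq')) one_le_two
  rcases mem_add_pair.1 hmid with hmid | hmid <;> refine h _ hmid ?_ ?_ <;>
    simp only [X_adj_iff, dir, Prod.fst_add, Prod.snd_add, Prod.fst_sub, Prod.snd_sub,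
      one_smul, Units.val_neg] <;>
    lia

theorem iff_of_lineIndex_eq {σ : ℤˣ} {A : Finset (ℤ × ℤ)} {P : ℤ × ℤ → Prop}
    (hconv : ConvexAlong (dir σ) (A : Set (ℤ × ℤ)))
    (hstep : ∀ p, p ∈ A → p + dir σ ∈ A → (P p ↔ P (p + dir σ)))
    {p q : ℤ × ℤ} (hp : p ∈ A) (hq : q ∈ A) (hpq : lineIndex σ p = lineIndex σ q) : P p ↔ P q := by
  wlog hle : p.1 ≤ q.1 generalizing p q
  · exact (this hq hp hpq.symm (le_of_not_ge hle)).symm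
  suffices ∀ n : ℕ, p + n • dir σ ∈ A → (P p ↔ P (p + n • dir σ)) by
    rw [eq_add_nsmul_dir hpq hle] at hq ⊢
    exact this _ hq
  intro n
  induction n with
  | zero => simp
  | succ n ih =>
    intro hn
    have hn' : p + n • dir σ ∈ A := hconv hp hn n.le_succ
    rw [succ_nsmul, ← add_assoc] at hn ⊢
    exact (ih hn').trans (hstep _ hn' hn)

/-- The vertex boundary as a finite set. -/
def boundary (A : Finset (ℤ × ℤ)) : Finset (ℤ × ℤ) := neighbors A \ A

theorem coe_boundary (A : Finset (ℤ × ℤ)) :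
    (boundary A : Set (ℤ × ℤ)) = vertexBoundary X (A : Set (ℤ × ℤ)) := by
  ext p
  simp [boundary, vertexBoundary, mem_neighbors, and_comm]

theorem card_boundary_add_card (A : Finset (ℤ × ℤ)) :
    #(boundary A) + #A = #(neighbors A ∪ A) :=
  Finset.card_sdiff_add_card _ _

theorem card_neighbors_le (A : Finset (ℤ × ℤ)) : #(neighbors A) ≤ #(boundary A) + #A := by
  rw [card_boundary_add_card]
  exact Finset.card_le_card Finset.subset_union_left

theorem subset_neighbors_of_card_le {A : Finset (ℤ × ℤ)}
    (h : #(boundary A) + #A ≤ #(neighbors A)) : A ⊆ neighbors A := by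
  rw [card_boundary_add_card] at h
  exact Finset.union_eq_left.1 (Finset.eq_of_subset_of_card_le Finset.subset_union_left h).symm

theorem parity_ne_of_adj {p q : ℤ × ℤ} (h : X.Adj p q) : parity p ≠ parity q := by
  rw [X_adj_iff] at h
  simp only [parity]
  lia

/-- The neighbours of a monochromatic set have the other colour, so that they are disjoint from the
set. -/
theorem card_neighbors_add_card_le {S A : Finset (ℤ × ℤ)} (hSA : S ⊆ A)
    (hS : ∀ p ∈ S, ∀ q ∈ S, parity p = parity q) :
    #(neighbors S) + #S ≤ #(boundary A) + #A := by
  have hdisj : Disjoint (neighbors S) S := Finset.disjoint_left.2 fun p hp hpS ↦ by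
    obtain ⟨q, hq, hpq⟩ := mem_neighbors.1 hp
    exact parity_ne_of_adj hpq (hS p hpS q hq)
  rw [← Finset.card_union_of_disjoint hdisj, card_boundary_add_card, neighbors, neighbors]
  gcongr

theorem two_mul_card_add_lineCount_lt {S A : Finset (ℤ × ℤ)} (hSA : S ⊆ A) (hne : S.Nonempty)
    (hS : ∀ p ∈ S, ∀ q ∈ S, parity p = parity q) :
    2 * #S + lineCount S < #(boundary A) + #A := by
  have hparity : 0 < #(S.image parity) := (hne.image _).card_pos
  linarith [card_neighbors_add_card_le hSA hS, card_add_lineCount_add_card_image_parity_le S]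

theorem card_image_filter_add_card_image_filter_not {α β : Type*} [DecidableEq β] {s : Finset α}
    {f : α → β} {P : α → Prop} [DecidablePred P]
    (h : ∀ p ∈ s, ∀ q ∈ s, f p = f q → (P p ↔ P q)) :
    #((s.filter P).image f) + #((s.filter (¬ P ·)).image f) = #(s.image f) := by
  classical
  rw [← Finset.card_union_of_disjoint, ← Finset.image_union, Finset.filter_union_filter_not_eq]
  simp only [Finset.disjoint_left, Finset.mem_image, Finset.mem_filter]
  rintro _ ⟨p, ⟨hp, hPp⟩, rfl⟩ ⟨q, ⟨hq, hPq⟩, hqp⟩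
  exact hPq ((h q hq p hp hqp).2 hPp)

theorem lineCount_filter_add_lineCount_filter_not {S : Finset (ℤ × ℤ)} {P : ℤ × ℤ → Prop}
    [DecidablePred P]
    (h : ∀ σ, ∀ p ∈ S, ∀ q ∈ S, lineIndex σ p = lineIndex σ q → (P p ↔ P q)) :
    lineCount (S.filter P) + lineCount (S.filter (¬ P ·)) = lineCount S := by
  simp only [lineCount, ← card_image_filter_add_card_image_filter_not (h 1),
    ← card_image_filter_add_card_image_filter_not (h (-1))]
  ring

theorem parity_eq_of_lineIndex_eq {σ : ℤˣ} {p q : ℤ × ℤ} (h : lineIndex σ p = lineIndex σ q) :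
    parity p = parity q := by
  rw [← lineIndex_emod_two σ, h, lineIndex_emod_two]

theorem four_mul_card_le_sq_lineCount (S : Finset (ℤ × ℤ)) : 4 * #S ≤ lineCount S ^ 2 := by
  have hinj : Function.Injective fun p : ℤ × ℤ ↦ (lineIndex 1 p, lineIndex (-1) p) :=
    fun p q h ↦ by
      simp only [lineIndex_apply, Prod.mk.injEq, Units.val_one, Units.val_neg] at h
      ext <;> lia
  have hcard : #S ≤ #(S.image (lineIndex 1)) * #(S.image (lineIndex (-1))) := by
    rw [← Finset.card_product]
    exact Finset.card_le_card_of_injOn _ (fun p hp ↦ Finset.mem_coe.2 <| Finset.mem_product.2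
      ⟨Finset.mem_image_of_mem _ hp, Finset.mem_image_of_mem _ hp⟩) hinj.injOn
  rw [lineCount]
  nlinarith [four_mul_le_sq_add #(S.image (lineIndex 1)) #(S.image (lineIndex (-1)))]

theorem two_le_lineCount {S : Finset (ℤ × ℤ)} (hS : S.Nonempty) : 2 ≤ lineCount S :=
  Nat.add_le_add (hS.image _).card_pos (hS.image _).card_pos

theorem four_mul_card_le_sq_lineCount_sub_one {S : Finset (ℤ × ℤ)} {P : ℤ × ℤ → Prop}
    [DecidablePred P]
    (hP : ∀ σ, ∀ p ∈ S, ∀ q ∈ S, lineIndex σ p = lineIndex σ q → (P p ↔ P q))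
    (hpos : (S.filter P).Nonempty) (hneg : (S.filter (¬ P ·)).Nonempty) :
    4 * #S ≤ (lineCount S - 1) ^ 2 := by
  rw [← lineCount_filter_add_lineCount_filter_not hP, ← Finset.card_filter_add_card_filter_not P]
  have h₁ := four_mul_card_le_sq_lineCount (S.filter P)
  have h₂ := four_mul_card_le_sq_lineCount (S.filter (¬ P ·))
  have hpos := two_le_lineCount hpos
  have hneg := two_le_lineCount hneg
  generalize lineCount (S.filter P) = k at *
  generalize lineCount (S.filter (¬ P ·)) = l at *
  zify [show 1 ≤ k + l by lia] at *
  nlinarith [mul_nonneg (sub_nonneg.2 hpos) (sub_nonneg.2 hneg)]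

theorem finite_box (α β : ℕ) : (box α β).Finite := by
  refine (Set.finite_Icc ((-α, 0) : ℤ × ℤ) (β, α + β)).subset fun p hp ↦ ?_
  simp only [box, Set.mem_ofPred_eq] at hp
  simp only [Set.mem_Icc, Prod.le_def]
  lia

/-- The box `B(α, β)` as a finite set. -/
noncomputable def boxFinset (α β : ℕ) : Finset (ℤ × ℤ) := (finite_box α β).toFinset

theorem mem_boxFinset {α β : ℕ} {p : ℤ × ℤ} : p ∈ boxFinset α β ↔
    (0 ≤ p.2 - p.1 ∧ p.2 - p.1 ≤ α) ∧ (0 ≤ p.2 + p.1 ∧ p.2 + p.1 ≤ β) := by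
  simp [boxFinset, box]

/-- The map `(x, y) ↦ (y - x, y + x)` identifies the box with the pairs of even sum in a rectangle,
and `1 + (-1) ^ n` is twice the indicator of the even numbers. -/
theorem two_mul_card_boxFinset (α β : ℕ) : 2 * (#(boxFinset α β) : ℤ) = (α + 1) * (β + 1) +
    (∑ i ∈ Finset.range (α + 1), (-1) ^ i) * ∑ j ∈ Finset.range (β + 1), (-1) ^ j := by
  have hcard : #(boxFinset α β) =
      #{q ∈ Finset.range (α + 1) ×ˢ Finset.range (β + 1) | Even (q.1 + q.2)} := by
    refine Finset.card_nbij' (fun p ↦ ((p.2 - p.1).toNat, (p.2 + p.1).toNat))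
      (fun q ↦ (((q.2 : ℤ) - q.1) / 2, ((q.2 : ℤ) + q.1) / 2)) ?_ ?_ ?_ ?_ <;>
      simp only [Set.MapsTo, Set.LeftInvOn, Finset.mem_coe, mem_boxFinset, Finset.mem_filter,
        Finset.mem_product, Finset.mem_range, Nat.even_iff, Prod.forall, Prod.ext_iff] <;>
      lia
  have hindicator (n : ℕ) : 2 * (if Even n then 1 else 0) = 1 + (-1 : ℤ) ^ n := by
    split_ifs with h
    · rw [h.neg_one_pow]; rfl
    · rw [(Nat.not_even_iff_odd.1 h).neg_one_pow]; rfl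
  rw [hcard, Finset.card_filter, Nat.cast_sum, Finset.mul_sum]
  simp only [Nat.cast_ite, Nat.cast_one, Nat.cast_zero, hindicator, Finset.sum_add_distrib,
    Finset.sum_const, Finset.card_product, Finset.card_range, nsmul_one, Finset.sum_product,
    pow_add, Finset.sum_mul_sum, Nat.cast_mul, Nat.cast_add]

theorem le_two_mul_card_boxFinset (α β : ℕ) : (α + 1) * (β + 1) ≤ 2 * #(boxFinset α β) := by
  have hsum (n : ℕ) : 0 ≤ ∑ i ∈ Finset.range n, (-1 : ℤ) ^ i := by
    rw [neg_one_geom_sum]; split_ifs <;> decide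
  zify
  rw [two_mul_card_boxFinset]
  linarith [mul_nonneg (hsum (α + 1)) (hsum (β + 1))]

theorem neighbors_union_subset_boxFinset (α β : ℕ) :
    neighbors (boxFinset α β) ∪ boxFinset α β ⊆ boxFinset (α + 2) (β + 2) + {(0, -1)} := by
  intro p hp
  rw [Finset.mem_union, mem_neighbors] at hp
  refine Finset.mem_add.2 ⟨(p.1, p.2 + 1), ?_, _, Finset.mem_singleton_self _, by simp⟩
  simp only [mem_boxFinset, X_adj_iff] at hp ⊢
  rcases hp with ⟨q, hp⟩ | hp <;> lia

theorem card_boundary_boxFinset_le (α β : ℕ) : #(boundary (boxFinset α β)) ≤ α + β + 4 := by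
  have hsubset := Finset.card_le_card (neighbors_union_subset_boxFinset α β)
  rw [Finset.card_add_singleton, ← card_boundary_add_card] at hsubset
  have hsum (n : ℕ) :
      ∑ i ∈ Finset.range (n + 2), (-1 : ℤ) ^ i = ∑ i ∈ Finset.range n, (-1) ^ i := by
    rw [Finset.sum_range_succ, Finset.sum_range_succ]; ring
  have hinner := two_mul_card_boxFinset α β
  have houter := two_mul_card_boxFinset (α + 2) (β + 2)
  rw [add_right_comm α, add_right_comm β, hsum, hsum] at houter
  push_cast at houter
  zify at hsubset ⊢
  linarith

theorem exists_sq_le_card_boundary_le {k : ℕ} (hk : 2 ≤ k) :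
    ∃ B : Finset (ℤ × ℤ), k ^ 2 ≤ 8 * #B + 1 ∧ #(boundary B) ≤ k + 2 := by
  obtain ⟨α, β, rfl, hαβ⟩ : ∃ α β, k = α + β + 2 ∧ (α = β ∨ β = α + 1) :=
    ⟨(k - 2) / 2, (k - 1) / 2, by lia, by lia⟩
  refine ⟨boxFinset α β, ?_, by linarith [card_boundary_boxFinset_le α β]⟩
  have := le_two_mul_card_boxFinset α β
  rcases hαβ with rfl | rfl <;> linarith

theorem exists_card_boundary_erase_le {A : Finset (ℤ × ℤ)} (hA : A.Nonempty) :
    ∃ p ∈ A, #(boundary (A.erase p)) ≤ #(boundary A) := by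
  obtain ⟨p, hp, hmax⟩ := A.exists_max_image Prod.fst hA
  refine ⟨p, hp, ?_⟩
  have hright : p + (1, 0) ∈ boundary A := by
    simp only [boundary, Finset.mem_sdiff, mem_neighbors, X_adj_iff]
    exact ⟨⟨p, hp, by simp⟩, fun h ↦ by simpa using hmax _ h⟩
  have hsubset : boundary (A.erase p) ⊆ insert p ((boundary A).erase (p + (1, 0))) := by
    intro q hq
    simp only [boundary, Finset.mem_sdiff, Finset.mem_insert, Finset.mem_erase,
      mem_neighbors] at hq ⊢
    obtain ⟨⟨r, ⟨hrp, hr⟩, hqr⟩, hqA⟩ := hq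
    refine or_iff_not_imp_left.2 fun hqp ↦ ⟨?_, ⟨r, hr, hqr⟩, fun h ↦ hqA ⟨hqp, h⟩⟩
    rintro rfl
    have := hmax r hr
    rw [X_adj_iff] at hqr
    simp only [ne_eq, Prod.ext_iff, Prod.fst_add, Prod.snd_add] at hrp hqr
    lia
  calc #(boundary (A.erase p)) ≤ #((boundary A).erase (p + (1, 0))) + 1 :=
        (Finset.card_le_card hsubset).trans (Finset.card_insert_le _ _)
    _ = #(boundary A) := Finset.card_erase_add_one hright

theorem exists_card_eq_card_boundary_le {n : ℕ} {B : Finset (ℤ × ℤ)} (hn : n ≤ #B) :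
    ∃ C, #C = n ∧ #(boundary C) ≤ #(boundary B) := by
  induction B using Finset.strongInduction with
  | H B ih =>
    obtain rfl | hlt := hn.eq_or_lt
    · exact ⟨B, rfl, le_rfl⟩
    have hB : B.Nonempty := Finset.card_pos.1 (by lia)
    obtain ⟨p, hp, hle⟩ := exists_card_boundary_erase_le hB
    obtain ⟨C, hC, hCle⟩ := ih _ (Finset.erase_ssubset hp)
      (Finset.card_erase_of_mem hp ▸ Nat.le_sub_one_of_lt hlt)
    exact ⟨C, hC, hCle.trans hle⟩

theorem IsMinimal.card_boundary_le {A B : Finset (ℤ × ℤ)} (hA : IsMinimal X (A : Set (ℤ × ℤ)))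
    (h : #A ≤ #B) : #(boundary A) ≤ #(boundary B) := by
  obtain ⟨C, hC, hCB⟩ := exists_card_eq_card_boundary_le h
  have hAC := hA.2 C (by simp only [Set.encard_coe_eq_coe_finsetCard, hC])
  rw [← coe_boundary, ← coe_boundary, Set.encard_coe_eq_coe_finsetCard,
    Set.encard_coe_eq_coe_finsetCard] at hAC
  exact (Nat.cast_le.1 hAC).trans hCB

theorem IsMinimal.sq_add_seven_le {A : Finset (ℤ × ℤ)} (hA : IsMinimal X (A : Set (ℤ × ℤ)))
    {k : ℕ} (hk : 2 ≤ k) (hboundary : k + 3 ≤ #(boundary A)) : k ^ 2 + 7 ≤ 8 * #A := by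
  obtain ⟨B, hkB, hB⟩ := exists_sq_le_card_boundary_le hk
  have : #B < #A := by
    by_contra! h
    linarith [hA.card_boundary_le h]
  linarith

/-- If `k` and `l` differ by at most `2`, then `8 * (a + b) ≤ (k + l) ^ 2 + (k - l) ^ 2` contradicts
the lower bound for `a + b`; otherwise the inequality for the larger one of them does. -/
theorem le_add_add_two {a b k l D : ℕ} (hk : 2 ≤ k) (hl : 2 ≤ l) (ha : 4 * a ≤ k ^ 2)
    (hb : 4 * b ≤ l ^ 2) (haD : a + k + 1 ≤ D + b) (hbD : b + l + 1 ≤ D + a)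
    (hsq : (D - 3) ^ 2 + 7 ≤ 8 * (a + b)) : D ≤ k + l + 2 := by
  by_contra! hD
  obtain ⟨K, rfl⟩ : ∃ K, D = K + 3 := ⟨D - 3, by lia⟩
  rw [Nat.add_sub_cancel] at hsq
  zify at *
  rcases lt_or_ge (l + 2 : ℤ) k with hkl | hkl
  · nlinarith
  rcases lt_or_ge (k + 2 : ℤ) l with hlk | hlk
  · nlinarith
  nlinarith

/-- `P` is invariant under the steps of `G` inside `A`, so that it is constant on the components of
`A`. -/
def AdjInvariantOn {V : Type*} (G : SimpleGraph V) (A : Set V) (P : V → Prop) : Prop :=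
  ∀ ⦃p⦄, p ∈ A → ∀ ⦃q⦄, q ∈ A → G.Adj p q → (P p ↔ P q)

theorem AdjInvariantOn.not {V : Type*} {G : SimpleGraph V} {A : Set V} {P : V → Prop}
    (hP : AdjInvariantOn G A P) : AdjInvariantOn G A (¬ P ·) :=
  fun _ hp _ hq hpq ↦ not_congr (hP hp hq hpq)

theorem isConnectedSet_iff {V : Type*} {G : SimpleGraph V} {A : Set V} :
    IsConnectedSet G A ↔ ∀ P, AdjInvariantOn G A P → ∀ p ∈ A, ∀ q ∈ A, P p → P q := by
  constructor
  · intro hA P hP p hp q hq hPp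
    have hreach := (SimpleGraph.reachable_iff_reflTransGen _ _).1 (hA ⟨p, hp⟩ ⟨q, hq⟩)
    suffices ∀ r : A, Relation.ReflTransGen (G.induce A).Adj ⟨p, hp⟩ r → P r from this _ hreach
    intro r hr
    induction hr with
    | refl => exact hPp
    | @tail r s _ hrs ih => exact (hP r.2 s.2 hrs).1 ih
  · rintro h ⟨p, hp⟩ ⟨q, hq⟩
    refine (h (fun r ↦ ∃ hr : r ∈ A, (G.induce A).Reachable ⟨p, hp⟩ ⟨r, hr⟩) ?_ p hp q hq
      ⟨hp, .rfl⟩).2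
    intro r hr s hs hrs
    have hadj : (G.induce A).Adj ⟨r, hr⟩ ⟨s, hs⟩ := hrs
    exact ⟨fun h ↦ ⟨hs, h.2.trans hadj.reachable⟩, fun h ↦ ⟨hr, h.2.trans hadj.symm.reachable⟩⟩

section Mixed

variable {A : Finset (ℤ × ℤ)}

theorem parity_eq_of_ne_zero {p q : ℤ × ℤ} (hp : parity p ≠ 0) (hq : parity q ≠ 0) :
    parity p = parity q := by
  simp only [parity] at hp hq ⊢
  lia

theorem two_le_of_four_mul_card_le_sq {S : Finset (ℤ × ℤ)} {k : ℕ} (hS : S.Nonempty)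
    (hk : 4 * #S ≤ k ^ 2) : 2 ≤ k := by
  have := hS.card_pos
  nlinarith

theorem IsMinimal.card_boundary_le_add_add_two (hA : IsMinimal X (A : Set (ℤ × ℤ)))
    (heven : {p ∈ A | parity p = 0}.Nonempty) (hodd : {p ∈ A | ¬ parity p = 0}.Nonempty) {k l : ℕ}
    (hk : k ≤ lineCount {p ∈ A | parity p = 0}) (hl : l ≤ lineCount {p ∈ A | ¬ parity p = 0})
    (hksq : 4 * #{p ∈ A | parity p = 0} ≤ k ^ 2)
    (hlsq : 4 * #{p ∈ A | ¬ parity p = 0} ≤ l ^ 2) : #(boundary A) ≤ k + l + 2 := by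
  have hcard := Finset.card_filter_add_card_filter_not (s := A) (parity · = 0)
  have hevenlt := two_mul_card_add_lineCount_lt (Finset.filter_subset (parity · = 0) A) heven
    fun p hp q hq ↦ by rw [(Finset.mem_filter.1 hp).2, (Finset.mem_filter.1 hq).2]
  have hoddlt := two_mul_card_add_lineCount_lt (Finset.filter_subset (¬ parity · = 0) A) hodd
    fun p hp q hq ↦ parity_eq_of_ne_zero (Finset.mem_filter.1 hp).2 (Finset.mem_filter.1 hq).2
  have hk2 := two_le_of_four_mul_card_le_sq heven hksq
  have hl2 := two_le_of_four_mul_card_le_sq hodd hlsq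
  by_contra! hlt
  refine hlt.not_ge (le_add_add_two hk2 hl2 hksq hlsq (by lia) (by lia) ?_)
  rw [hcard]
  exact hA.sq_add_seven_le (by lia) (by lia)

theorem lineCount_even_add_lineCount_odd (A : Finset (ℤ × ℤ)) :
    lineCount {p ∈ A | parity p = 0} + lineCount {p ∈ A | ¬ parity p = 0} = lineCount A :=
  lineCount_filter_add_lineCount_filter_not fun _ _ _ _ _ h ↦ by rw [parity_eq_of_lineIndex_eq h]

theorem two_le_card_image_parity (heven : {p ∈ A | parity p = 0}.Nonempty)
    (hodd : {p ∈ A | ¬ parity p = 0}.Nonempty) : 2 ≤ #(A.image parity) := by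
  obtain ⟨p, hp⟩ := heven
  obtain ⟨q, hq⟩ := hodd
  rw [Finset.mem_filter] at hp hq
  exact Finset.one_lt_card.2 ⟨_, Finset.mem_image_of_mem _ hp.1, _, Finset.mem_image_of_mem _ hq.1,
    fun h ↦ hq.2 (h ▸ hp.2)⟩

theorem IsMinimal.subset_neighbors_and_convexAlong (hA : IsMinimal X (A : Set (ℤ × ℤ)))
    (heven : {p ∈ A | parity p = 0}.Nonempty) (hodd : {p ∈ A | ¬ parity p = 0}.Nonempty) :
    A ⊆ neighbors A ∧ ∀ σ, ConvexAlong (dir σ) (A : Set (ℤ × ℤ)) ∧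
      ConvexAlong (dir (-σ)) (↑(A + {0, dir σ}) : Set (ℤ × ℤ)) := by
  have hupper := hA.card_boundary_le_add_add_two heven hodd le_rfl le_rfl
    (four_mul_card_le_sq_lineCount _) (four_mul_card_le_sq_lineCount _)
  rw [lineCount_even_add_lineCount_odd] at hupper
  have hlower := card_add_lineCount_add_card_image_parity_le A
  have hparity := two_le_card_image_parity heven hodd
  have hneighbors := card_neighbors_le A
  exact ⟨subset_neighbors_of_card_le (by lia),
    fun σ ↦ convexAlong_of_card_neighbors_le σ (by lia)⟩

theorem filter_parity_filter_nonempty {P : ℤ × ℤ → Prop} [DecidablePred P] (hA : A ⊆ neighbors A)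
    (hP : AdjInvariantOn X A P) {p : ℤ × ℤ} (hp : p ∈ A) (hPp : P p) :
    ({q ∈ A | parity q = 0}.filter P).Nonempty ∧ ({q ∈ A | ¬ parity q = 0}.filter P).Nonempty := by
  obtain ⟨q, hq, hpq⟩ := mem_neighbors.1 (hA hp)
  have hPq := (hP hp hq hpq).1 hPp
  have hne := parity_ne_of_adj hpq
  have hcases : parity p = 0 ∧ ¬ parity q = 0 ∨ ¬ parity p = 0 ∧ parity q = 0 := by
    simp only [parity] at hne ⊢
    lia
  rcases hcases with ⟨h, h'⟩ | ⟨h, h'⟩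
  · exact ⟨⟨p, by simp [hp, h, hPp]⟩, ⟨q, by simp [hq, h', hPq]⟩⟩
  · exact ⟨⟨q, by simp [hq, h', hPq]⟩, ⟨p, by simp [hp, h, hPp]⟩⟩

theorem iff_of_adjInvariantOn_of_lineIndex_eq {P : ℤ × ℤ → Prop} {σ : ℤˣ} (hA : A ⊆ neighbors A)
    (hconv : ConvexAlong (dir σ) (A : Set (ℤ × ℤ)))
    (hconv' : ConvexAlong (dir σ) (↑(A + {0, dir (-σ)}) : Set (ℤ × ℤ)))
    (hP : AdjInvariantOn X A P) {p q : ℤ × ℤ} (hp : p ∈ A) (hq : q ∈ A)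
    (hpq : lineIndex σ p = lineIndex σ q) : P p ↔ P q := by
  refine iff_of_lineIndex_eq hconv (fun r hr hr' ↦ ?_) hp hq hpq
  obtain ⟨t, ht, hrt, hrt'⟩ := exists_common_neighbor hconv' hA hr hr'
  exact (hP hr ht hrt).trans (hP hr' ht hrt').symm

/-- If `A` were a union of two parts without edges between them, both colour classes of `A` would
split along lines, and so would occupy at least one line more than their sizes require. -/
theorem IsMinimal.isConnectedSet_of_mixed (hA : IsMinimal X (A : Set (ℤ × ℤ)))
    (heven : {p ∈ A | parity p = 0}.Nonempty) (hodd : {p ∈ A | ¬ parity p = 0}.Nonempty) :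
    IsConnectedSet X (A : Set (ℤ × ℤ)) := by
  classical
  obtain ⟨hneighbors, hconv⟩ := hA.subset_neighbors_and_convexAlong heven hodd
  refine isConnectedSet_iff.2 fun P hP p hp q hq hPp ↦ ?_
  by_contra hPq
  have hlines σ : ∀ p ∈ A, ∀ q ∈ A, lineIndex σ p = lineIndex σ q → (P p ↔ P q) :=
    fun p hp q hq ↦ iff_of_adjInvariantOn_of_lineIndex_eq hneighbors (hconv σ).1
      (by simpa only [neg_neg] using (hconv (-σ)).2) hP hp hq
  obtain ⟨hevenP, hoddP⟩ := filter_parity_filter_nonempty hneighbors hP hp hPp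
  obtain ⟨hevenN, hoddN⟩ := filter_parity_filter_nonempty hneighbors hP.not hq hPq
  have hsplit {Q : ℤ × ℤ → Prop} [DecidablePred Q] : ∀ σ, ∀ p ∈ A.filter Q, ∀ q ∈ A.filter Q,
      lineIndex σ p = lineIndex σ q → (P p ↔ P q) := fun σ p hp q hq ↦
    hlines σ p (Finset.mem_of_mem_filter _ hp) q (Finset.mem_of_mem_filter _ hq)
  have hupper := hA.card_boundary_le_add_add_two heven hodd (Nat.sub_le _ 1) (Nat.sub_le _ 1)
    (four_mul_card_le_sq_lineCount_sub_one hsplit hevenP hevenN)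
    (four_mul_card_le_sq_lineCount_sub_one hsplit hoddP hoddN)
  have htotal := lineCount_even_add_lineCount_odd A
  have hlower := card_add_lineCount_add_card_image_parity_le A
  have hparity := two_le_card_image_parity heven hodd
  have hcard := card_neighbors_le A
  have := two_le_lineCount heven
  lia

end Mixed

section Monochromatic

variable {A : Finset (ℤ × ℤ)}

theorem IsMinimal.card_le_two (hA : IsMinimal X (A : Set (ℤ × ℤ)))
    (hparity : ∀ p ∈ A, ∀ q ∈ A, parity p = parity q) : #A ≤ 2 := by
  by_contra! hcard
  have hlt := two_mul_card_add_lineCount_lt subset_rfl (Finset.card_pos.1 (by lia)) hparity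
  have hline := four_mul_card_le_sq_lineCount A
  have hfour : 4 ≤ lineCount A := by nlinarith
  have := hA.sq_add_seven_le (k := #A + 2) (by lia) (by lia)
  nlinarith

theorem IsMinimal.card_boundary_le_six (hA : IsMinimal X (A : Set (ℤ × ℤ))) (hcard : #A = 2) :
    #(boundary A) ≤ 6 := by
  by_contra! hlt
  have := hA.sq_add_seven_le (k := 4) (by lia) (by lia)
  lia

theorem exists_lineIndex_eq_of_lineCount_le_three (hline : lineCount A ≤ 3) :
    ∃ σ, ∀ p ∈ A, ∀ q ∈ A, lineIndex σ p = lineIndex σ q := by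
  have hone : #(A.image (lineIndex 1)) ≤ 1 ∨ #(A.image (lineIndex (-1))) ≤ 1 := by
    rw [lineCount] at hline
    lia
  rcases hone with h | h <;>
    exact ⟨_, fun p hp q hq ↦ Finset.card_le_one.1 h _ (Finset.mem_image_of_mem _ hp) _
      (Finset.mem_image_of_mem _ hq)⟩

theorem exists_eq_pair_of_convexAlong {σ : ℤˣ} (hcard : #A = 2)
    (hline : ∀ p ∈ A, ∀ q ∈ A, lineIndex σ p = lineIndex σ q)
    (hconv : ConvexAlong (dir σ) (A : Set (ℤ × ℤ))) : ∃ p, A = {p, p + dir σ} := by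
  obtain ⟨p, q, hpq, rfl⟩ := Finset.card_eq_two.1 hcard
  wlog hle : p.1 ≤ q.1 generalizing p q
  · rw [Finset.pair_comm p q] at *
    exact this q p hpq.symm hcard hline hconv (le_of_not_ge hle)
  have hq := eq_add_nsmul_dir (hline p (by simp) q (by simp)) hle
  have hn : (q.1 - p.1).toNat ≠ 0 := fun h ↦ hpq (by rw [hq, h, zero_smul, add_zero])
  have hmem : p + dir σ ∈ ({p, q} : Finset (ℤ × ℤ)) := by
    simpa using hconv (p := p) (m := 1) (n := (q.1 - p.1).toNat) (by simp)
      (hq ▸ by simp) (Nat.one_le_iff_ne_zero.2 hn)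
  have hne : p + dir σ ≠ p := fun h ↦ not_isOfFinAddOrder_dir σ <| by
    rw [add_eq_left.1 h]
    exact .zero
  refine ⟨p, ?_⟩
  rw [Finset.mem_singleton.1 (Finset.mem_of_mem_insert_of_ne hmem hne)]

theorem IsMinimal.subsingleton_or_eq_pair (hA : IsMinimal X (A : Set (ℤ × ℤ)))
    (hparity : ∀ p ∈ A, ∀ q ∈ A, parity p = parity q) :
    (A : Set (ℤ × ℤ)).Subsingleton ∨ ∃ p σ, A = {p, p + dir σ} := by
  rcases (hA.card_le_two hparity).lt_or_eq with hlt | hcard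
  · exact .inl (Finset.card_le_one.1 (Nat.le_of_lt_succ hlt))
  have hne : A.Nonempty := Finset.card_pos.1 (by lia)
  have hboundary := hA.card_boundary_le_six hcard
  have hlt := two_mul_card_add_lineCount_lt subset_rfl hne hparity
  have hneighbors := card_neighbors_add_card_le subset_rfl hparity
  have hsq := four_mul_card_le_sq_lineCount A
  have hthree : 3 ≤ lineCount A := by nlinarith
  have hcolor : 0 < #(A.image parity) := (hne.image _).card_pos
  obtain ⟨σ, hσ⟩ := exists_lineIndex_eq_of_lineCount_le_three (A := A) (by lia)
  have hconv := (convexAlong_of_card_neighbors_le σ (S := A) (by lia)).1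
  obtain ⟨p, hp⟩ := exists_eq_pair_of_convexAlong hcard hσ hconv
  exact .inr ⟨p, σ, hp⟩

end Monochromatic

theorem isConnectedSet_of_subsingleton {V : Type*} {G : SimpleGraph V} {A : Set V}
    (hA : A.Subsingleton) : IsConnectedSet G A :=
  isConnectedSet_iff.2 fun _ _ _ hp _ hq h ↦ hA hp hq ▸ h

theorem convexAlong_of_subsingleton {M : Type*} [AddLeftCancelMonoid M] {d : M} {S : Set M}
    (hd : ¬ IsOfFinAddOrder d) (hS : S.Subsingleton) : ConvexAlong d S := by
  intro p m n hp hpn hmn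
  have hn : n • d = 0 • d := by rw [zero_nsmul, add_eq_left.1 (hS hpn hp)]
  obtain rfl := injective_nsmul_iff_not_isOfFinAddOrder.2 hd hn
  rwa [Nat.le_zero.1 hmn, zero_nsmul, add_zero]

theorem filter_parity_nonempty {A : Finset (ℤ × ℤ)}
    (h : ∃ p ∈ A, ∃ q ∈ A, parity p ≠ parity q) :
    {p ∈ A | parity p = 0}.Nonempty ∧ {p ∈ A | ¬ parity p = 0}.Nonempty := by
  obtain ⟨p, hp, q, hq, hpq⟩ := h
  simp only [Finset.filter_nonempty_iff]
  by_cases hp0 : parity p = 0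
  · exact ⟨⟨p, hp, hp0⟩, q, hq, fun hq0 ↦ hpq (hp0.trans hq0.symm)⟩
  · exact ⟨⟨q, hq, by_contra fun hq0 ↦ hpq (parity_eq_of_ne_zero hp0 hq0)⟩, p, hp, hp0⟩

theorem IsMinimal.isConnectedSet_and_convexAlong_or_eq_pair {A : Set (ℤ × ℤ)}
    (hA : IsMinimal X A) : (IsConnectedSet X A ∧ ∀ σ, ConvexAlong (dir σ) A) ∨
      ∃ p σ, A = {p, p + dir σ} := by
  lift A to Finset (ℤ × ℤ) using hA.1
  by_cases hparity : ∀ p ∈ A, ∀ q ∈ A, parity p = parity q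
  · refine (hA.subsingleton_or_eq_pair hparity).imp
      (fun h ↦ ⟨isConnectedSet_of_subsingleton h,
        fun σ ↦ convexAlong_of_subsingleton (not_isOfFinAddOrder_dir σ) h⟩) ?_
    rintro ⟨p, σ, rfl⟩
    exact ⟨p, σ, Finset.coe_pair⟩
  · push Not at hparity
    obtain ⟨heven, hodd⟩ := filter_parity_nonempty hparity
    exact .inl ⟨hA.isConnectedSet_of_mixed heven hodd,
      fun σ ↦ ((hA.subset_neighbors_and_convexAlong heven hodd).2 σ).1⟩

theorem ConvexAlong.mem_of_lineIndex_eq {σ : ℤˣ} {A : Set (ℤ × ℤ)}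
    (hA : ConvexAlong (dir σ) A) {p q z : ℤ × ℤ} (hp : p ∈ A) (hq : q ∈ A)
    (hpz : lineIndex σ p = lineIndex σ z) (hzq : lineIndex σ z = lineIndex σ q)
    (hle : p.1 ≤ z.1) (hle' : z.1 ≤ q.1) : z ∈ A := by
  rw [eq_add_nsmul_dir (hpz.trans hzq) (hle.trans hle')] at hq
  rw [eq_add_nsmul_dir hpz hle]
  exact hA hp hq (by lia)

theorem ConvexAlong.exists_forall_mul_lineIndex_sub_neg {σ : ℤˣ} {A : Set (ℤ × ℤ)}
    (hA : ConvexAlong (dir σ) A) {z : ℤ × ℤ} (hz : z ∉ A) :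
    ∃ τ : ℤˣ, ∀ p ∈ A, lineIndex σ p = lineIndex σ z →
      τ * (lineIndex (-σ) p - lineIndex (-σ) z) < 0 := by
  by_contra! h
  obtain ⟨p, hp, hpσ, hp'⟩ := h 1
  obtain ⟨q, hq, hqσ, hq'⟩ := h (-1)
  refine hz ?_
  have hpz := hpσ
  have hqz := hqσ
  simp only [lineIndex_apply, Units.val_neg, Units.val_one] at hpz hqz hp' hq'
  rcases Int.isUnit_iff.1 σ.isUnit with hσ | hσ <;> rw [hσ] at hpz hqz hp' hq'
  · exact hA.mem_of_lineIndex_eq hq hp hqσ hpσ.symm (by lia) (by lia)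
  · exact hA.mem_of_lineIndex_eq hp hq hpσ hqσ.symm (by lia) (by lia)

/-- The four cones with apex `z`, indexed by the signs of `y - x` and `y + x` relative to `z`. -/
def quadrant (z : ℤ × ℤ) (σ τ : ℤˣ) : Set (ℤ × ℤ) :=
  {p | 0 ≤ σ * (lineIndex 1 p - lineIndex 1 z) ∧ 0 ≤ τ * (lineIndex (-1) p - lineIndex (-1) z)}

theorem self_mem_quadrant (z : ℤ × ℤ) (σ τ : ℤˣ) : z ∈ quadrant z σ τ := by
  simp [quadrant]

/-- A step of `X` changes both `y - x` and `y + x` by `±1`, so that a path can only leave the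
quadrant through one of its two sides. -/
theorem adjInvariantOn_mem_quadrant {A : Set (ℤ × ℤ)} {z : ℤ × ℤ} {σ τ : ℤˣ}
    (hσ : ∀ p ∈ A, lineIndex (-1) p = lineIndex (-1) z →
      σ * (lineIndex 1 p - lineIndex 1 z) < 0)
    (hτ : ∀ p ∈ A, lineIndex 1 p = lineIndex 1 z →
      τ * (lineIndex (-1) p - lineIndex (-1) z) < 0) :
    AdjInvariantOn X A (· ∈ quadrant z σ τ) := by
  have himp : ∀ p ∈ A, ∀ q, X.Adj p q → p ∈ quadrant z σ τ → q ∈ quadrant z σ τ := by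
    intro p hp q hpq hpz
    have h₁ := hσ p hp
    have h₂ := hτ p hp
    rw [X_adj_iff] at hpq
    simp only [quadrant, Set.mem_ofPred_eq, lineIndex_apply, Units.val_one, Units.val_neg]
      at h₁ h₂ hpz ⊢
    rcases Int.isUnit_iff.1 σ.isUnit with hs | hs <;>
      rcases Int.isUnit_iff.1 τ.isUnit with ht | ht <;>
      simp only [hs, ht] at h₁ h₂ hpz ⊢ <;> lia
  exact fun p hp q hq hpq ↦ ⟨himp p hp q hpq, himp q hq p hpq.symm⟩

/-- Each of the two diagonal lines through `z` contains a half-line missed by `A`. If the quadrant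
spanned by these half-lines is not missed by `A`, then it contains `A`, and the opposite one is
missed. -/
theorem IsConnectedSet.exists_disjoint_quadrant {A : Set (ℤ × ℤ)} (hA : IsConnectedSet X A)
    (hconv : ∀ σ, ConvexAlong (dir σ) A) {z : ℤ × ℤ} (hz : z ∉ A) :
    ∃ σ τ, Disjoint (quadrant z σ τ) A := by
  obtain ⟨τ, hτ⟩ := (hconv 1).exists_forall_mul_lineIndex_sub_neg hz
  obtain ⟨σ, hσ⟩ := (hconv (-1)).exists_forall_mul_lineIndex_sub_neg hz
  rw [neg_neg] at hσ
  have hinv := adjInvariantOn_mem_quadrant hσ hτ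
  by_cases hdisj : Disjoint (quadrant z σ τ) A
  · exact ⟨σ, τ, hdisj⟩
  obtain ⟨p, hpz, hp⟩ := Set.not_disjoint_iff.1 hdisj
  refine ⟨-σ, -τ, Set.disjoint_left.2 fun q hqz hq ↦ ?_⟩
  obtain ⟨h₁, h₂⟩ := isConnectedSet_iff.1 hA _ hinv p hp q hq hpz
  obtain ⟨h₃, h₄⟩ := hqz
  simp only [Units.val_neg, neg_mul] at h₃ h₄
  have h₅ := hτ q hq
  have h₆ := hσ q hq
  rcases Int.isUnit_iff.1 σ.isUnit with hs | hs <;>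
    rcases Int.isUnit_iff.1 τ.isUnit with ht | ht <;>
    simp only [hs, ht] at h₁ h₂ h₃ h₄ h₅ h₆ <;> lia

theorem exists_disjoint_quadrant_pair {p z : ℤ × ℤ} {ρ : ℤˣ}
    (hz : z ∉ ({p, p + dir ρ} : Set (ℤ × ℤ))) :
    ∃ σ τ, Disjoint (quadrant z σ τ) {p, p + dir ρ} := by
  simp only [Set.disjoint_insert_right, Set.disjoint_singleton_right]
  by_contra! h
  have h₁ := h 1 1
  have h₂ := h 1 (-1)
  have h₃ := h (-1) 1
  have h₄ := h (-1) (-1)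
  simp only [quadrant, lineIndex_apply, dir, Set.mem_ofPred_eq, Set.mem_insert_iff,
    Set.mem_singleton_iff, Prod.ext_iff, Prod.fst_add, Prod.snd_add, Units.val_neg,
    Units.val_one] at hz h₁ h₂ h₃ h₄
  rcases Int.isUnit_iff.1 ρ.isUnit with hρ | hρ <;> simp only [hρ] at hz <;> lia

theorem congruent_of_forall_mem_iff {V : Type*} {G : SimpleGraph V} {A B : Set V} (φ : G ≃g G)
    (h : ∀ p, p ∈ A ↔ φ p ∈ B) : Congruent G A B :=
  ⟨φ, (φ.toEquiv.eq_preimage_iff_image_eq A B).1 (Set.ext h)⟩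

/-- The translation by `-z`. -/
def translateIso (z : ℤ × ℤ) : X ≃g X where
  toEquiv := Equiv.subRight z
  map_rel_iff' := by intro p q; simp [X]

theorem translateIso_apply (z p : ℤ × ℤ) : translateIso z p = p - z := rfl

/-- The reflections `(x, y) ↦ (±x, ±y)` in the coordinate axes and their products. -/
def signIso (σ τ : ℤˣ) : X ≃g X where
  toEquiv := Equiv.prodCongr (Units.mulLeft σ) (Units.mulLeft τ)
  map_rel_iff' := by
    intro p q
    simp [X, ← mul_sub, abs_mul, Int.isUnit_iff_abs_eq.1]

theorem signIso_apply (σ τ : ℤˣ) (p : ℤ × ℤ) : signIso σ τ p = (σ * p.1, τ * p.2) := rfl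

/-- The reflection `(x, y) ↦ (y, x)`. -/
def swapIso : X ≃g X where
  toEquiv := Equiv.prodComm ℤ ℤ
  map_rel_iff' := by
    intro p q
    simp [X, add_comm]

theorem swapIso_apply (p : ℤ × ℤ) : swapIso p = (p.2, p.1) := rfl

theorem isCone_quadrant (z : ℤ × ℤ) (σ τ : ℤˣ) : IsCone (quadrant z σ τ) := by
  have hcases : τ = σ ∨ τ = -σ := by
    rcases Int.units_eq_one_or σ with rfl | rfl <;> rcases Int.units_eq_one_or τ with rfl | rfl <;>
      simp
  rcases hcases with rfl | rfl
  · refine congruent_of_forall_mem_iff ((translateIso z).trans (signIso τ τ)) fun p ↦ ?_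
    simp only [quadrant, standardCone, Set.mem_ofPred_eq, lineIndex_apply, RelIso.trans_apply,
      translateIso_apply, signIso_apply, Prod.fst_sub, Prod.snd_sub, Units.val_one, Units.val_neg]
    rcases Int.isUnit_iff.1 τ.isUnit with hτ | hτ <;> simp only [hτ] <;> lia
  · refine congruent_of_forall_mem_iff
      (((translateIso z).trans swapIso).trans (signIso (-σ) (-σ))) fun p ↦ ?_
    simp only [quadrant, standardCone, Set.mem_ofPred_eq, lineIndex_apply, RelIso.trans_apply,
      translateIso_apply, swapIso_apply, signIso_apply, Prod.fst_sub, Prod.snd_sub, Units.val_one,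
      Units.val_neg]
    rcases Int.isUnit_iff.1 σ.isUnit with hσ | hσ <;> simp only [hσ] <;> lia

theorem isUnionOfCones_compl {A : Set (ℤ × ℤ)}
    (hA : ∀ z ∉ A, ∃ σ τ, Disjoint (quadrant z σ τ) A) : IsUnionOfCones Aᶜ := by
  refine ⟨{C | IsCone C ∧ C ⊆ Aᶜ}, fun C hC ↦ hC.1, subset_antisymm (fun z hz ↦ ?_)
    (Set.sUnion_subset fun C hC ↦ hC.2)⟩
  obtain ⟨σ, τ, hdisj⟩ := hA z hz
  exact ⟨_, ⟨isCone_quadrant z σ τ, hdisj.subset_compl_right⟩, self_mem_quadrant z σ τ⟩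

theorem congruent_pair_box (p : ℤ × ℤ) (σ : ℤˣ) : Congruent X {p, p + dir σ} (box 0 2) := by
  refine congruent_of_forall_mem_iff ((translateIso p).trans (signIso 1 σ)) fun q ↦ ?_
  simp only [box, dir, Set.mem_ofPred_eq, Set.mem_insert_iff, Set.mem_singleton_iff, Prod.ext_iff,
    RelIso.trans_apply, translateIso_apply, signIso_apply, Prod.fst_add, Prod.snd_add,
    Prod.fst_sub, Prod.snd_sub, Units.val_one]
  rcases Int.isUnit_iff.1 σ.isUnit with hσ | hσ <;> simp only [hσ] <;> lia

theorem not_adj_of_mem_box {p q : ℤ × ℤ} (hp : p ∈ box 0 2) (hq : q ∈ box 0 2) :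
    ¬ X.Adj p q := by
  rw [X_adj_iff]
  simp only [box, Set.mem_ofPred_eq] at hp hq
  lia

theorem IsConnectedSet.subsingleton {V : Type*} {G : SimpleGraph V} {A : Set V}
    (hA : IsConnectedSet G A) (hadj : ∀ p ∈ A, ∀ q ∈ A, ¬ G.Adj p q) : A.Subsingleton :=
  fun p hp q hq ↦ isConnectedSet_iff.1 hA (p = ·)
    (fun r hr s hs hrs ↦ (hadj r hr s hs hrs).elim) p hp q hq rfl

theorem not_isConnectedSet_of_congruent_box {A : Set (ℤ × ℤ)} (hA : Congruent X A (box 0 2)) :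
    ¬ IsConnectedSet X A := by
  obtain ⟨φ, hφ⟩ := hA
  intro hconn
  have hsub : A.Subsingleton := hconn.subsingleton fun p hp q hq hpq ↦
    not_adj_of_mem_box (hφ ▸ Set.mem_image_of_mem φ hp) (hφ ▸ Set.mem_image_of_mem φ hq)
      (φ.map_adj_iff.2 hpq)
  have hbox := hφ ▸ hsub.image φ
  have h : ((0, 0) : ℤ × ℤ) = (1, 1) := hbox (by simp [box]) (by simp [box])
  simp at h

end L1Lattice

theorem mainTheorem7 (A : Set (ℤ × ℤ)) (hA : L1Lattice.IsMinimal L1Lattice.X A) :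
    (L1Lattice.IsConnectedSet L1Lattice.X A ↔
      ¬ L1Lattice.Congruent L1Lattice.X A (L1Lattice.box 0 2)) ∧
    L1Lattice.IsUnionOfCones Aᶜ := by
  rcases hA.isConnectedSet_and_convexAlong_or_eq_pair with ⟨hconn, hconv⟩ | ⟨p, σ, rfl⟩
  · exact ⟨iff_of_true hconn fun hbox ↦ L1Lattice.not_isConnectedSet_of_congruent_box hbox hconn,
      L1Lattice.isUnionOfCones_compl fun _ ↦ hconn.exists_disjoint_quadrant hconv⟩
  · have hbox := L1Lattice.congruent_pair_box p σ
    exact ⟨iff_of_false (L1Lattice.not_isConnectedSet_of_congruent_box hbox) (not_not.2 hbox),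
      L1Lattice.isUnionOfCones_compl fun _ ↦ L1Lattice.exists_disjoint_quadrant_pair⟩
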